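/- Conventions. A spacetime is a smooth connected (Hausdorff, second countable) 4-manifold $M$ with a smooth Lorentzian metric $g$ of signature $(-,+,+,+)$ and a time orientation, given by a smooth timelike vector field $T$: a causal vector $X$ is future-directed iff $g(X,T)<0$. Smooth vacuum initial data $(\tilde\Sigma,\tilde g,\tilde k)$ consist of a smooth 3-manifold $\tilde\Sigma$ with a Riemannian metric $\tilde g$ and a symmetric 2-tensor $\tilde k$, both smooth, satisfying the constraints $\tilde R-\mathrm{Tr}(\tilde k^2)+\mathrm{Tr}(\tilde k)^2=0$ and $\tilde\nabla_j\tilde k_i^{\,j}-\tilde\nabla_i\mathrm{Tr}(\tilde k)=0$. A globally hyperbolic development of these data is a triple $(M,g,\iota)$ in which $(M,g)$ is a spacetime with $R_{\mu\nu}=0$ and $\iota:\tilde\Sigma\to M$ is an embedding such that $\iota(\tilde\Sigma)$ is a Cauchy surface (it is met exactly once by every inextendible timelike curve), $\iota^*g=\tilde g$, and $\tilde k(X,Y)=-g(\nabla_XN,Y)$ with $N$ the future-directed unit normal of $\iota(\tilde\Sigma)$. It is a maximal globally hyperbolic development (MGHD) if for every globally hyperbolic development $(M',g',\iota')$ of the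 same data there is an embedding $\theta:M'\to M$ that preserves time orientation and satisfies $\theta^*g=g'$ and $\theta\circ\iota'=\iota$. Proposition. Let $(M,g,\iota)$ be an MGHD of smooth vacuum initial data $(\tilde\Sigma,\tilde g,\tilde k)$, with time orientation given by $T$, let $U$ be a neighbourhood of $\iota(\tilde\Sigma)$ in $M$, and let $\psi$ be a diffeomorphism of $M$ that is the identity on $U$. Then $(M,\psi^*g,\iota)$, with the time orientation given by $\psi^{-1}_*T$, is an MGHD of the same initial data $(\tilde\Sigma,\tilde g,\tilde k)$. More generally this holds for every time orientation of $(M,\psi^*g)$ for which $\psi:(M,\psi^*g)\to(M,g)$ preserves time orientation. -/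

import Mathlib

open Set Filter
open scoped Manifold ContDiff Topology Bundle

noncomputable section

namespace GR

universe u v

/-- The model space `ℝⁿ`. -/
abbrev Model (n : ℕ) : Type := EuclideanSpace ℝ (Fin n)

/-! ### Covariant 2-tensors -/

/-- A (not necessarily smooth) field of bilinear forms on the tangent spaces of an
`n`-dimensional manifold. -/
abbrev TwoTensor (n : ℕ) (M : Type u) [TopologicalSpace M] [ChartedSpace (Model n) M] : Type u :=
  ∀ x : M, TangentSpace (𝓡 n) x →L[ℝ] TangentSpace (𝓡 n) x →L[ℝ] ℝ

/-- A (not necessarily smooth) vector field. -/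
abbrev VField (n : ℕ) (M : Type u) [TopologicalSpace M] [ChartedSpace (Model n) M] : Type u :=
  ∀ x : M, TangentSpace (𝓡 n) x

section Tensors

variable {n m : ℕ} {M : Type u} [TopologicalSpace M] [ChartedSpace (Model n) M]
  {N : Type v} [TopologicalSpace N] [ChartedSpace (Model m) N]

/-- Smoothness of a field of bilinear forms, as a section of the bundle of bilinear forms. -/
def IsSmoothTensor [IsManifold (𝓡 n) ∞ M] (g : TwoTensor n M) : Prop :=
  ContMDiff (𝓡 n) ((𝓡 n).prod 𝓘(ℝ, Model n →L[ℝ] Model n →L[ℝ] ℝ)) ∞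
    (fun x ↦ Bundle.TotalSpace.mk' (Model n →L[ℝ] Model n →L[ℝ] ℝ)
      (E := fun x : M ↦ TangentSpace (𝓡 n) x →L[ℝ] TangentSpace (𝓡 n) x →L[ℝ] ℝ) x (g x))

/-- Smoothness of a vector field. -/
def IsSmoothField [IsManifold (𝓡 n) ∞ M] (X : VField n M) : Prop :=
  ContMDiff (𝓡 n) (𝓡 n).tangent ∞ (fun x ↦ (X x : TangentBundle (𝓡 n) M))

/-- The pullback `f^* g`, that is `(f^* g)_x (u, v) = g_{f x} (df u, df v)`. -/
def pullback (f : M → N) (g : TwoTensor m N) : TwoTensor n M := fun x ↦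
  (mfderiv (𝓡 n) (𝓡 m) f x).precomp ℝ ∘L g (f x) ∘L mfderiv (𝓡 n) (𝓡 m) f x

/-- The components of a 2-tensor in the preferred chart `φ` around `x`: the function
`y ↦ ((φ⁻¹)^* g)_y` from (the target of `φ` in) `ℝⁿ` to bilinear forms on `ℝⁿ`. -/
def coordRep (g : TwoTensor n M) (x : M) : Model n → (Model n →L[ℝ] Model n →L[ℝ] ℝ) :=
  pullback (n := n) (m := n) (extChartAt (𝓡 n) x).symm g

end Tensors

/-! ### Levi-Civita connection and curvature in coordinates -/

section Coordinates

variable {n : ℕ}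

/-- Christoffel symbols of a (pseudo-)Riemannian metric `G` on an open set of `ℝⁿ`:
`Γ_y(u, v)` is the vector with
`G_y(Γ_y(u, v), w) = (∂_u G(v, w) + ∂_v G(u, w) - ∂_w G(u, v)) / 2` for all `w`. -/
def christoffel (G : Model n → (Model n →L[ℝ] Model n →L[ℝ] ℝ)) (y u v : Model n) : Model n :=
  (G y).inverse
    ((1 / 2 : ℝ) • (fderiv ℝ G y u v + fderiv ℝ G y v u - ((fderiv ℝ G y).flip u).flip v))

/-- The curvature `R(u, v) w` of the connection with the above Christoffel symbols, with the sign
convention `R(X, Y) = [∇_X, ∇_Y] - ∇_[X, Y]`. -/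
def riemannCoord (G : Model n → (Model n →L[ℝ] Model n →L[ℝ] ℝ)) (y u v w : Model n) : Model n :=
  fderiv ℝ (fun z ↦ christoffel G z v w) y u - fderiv ℝ (fun z ↦ christoffel G z u w) y v
    + christoffel G y u (christoffel G y v w) - christoffel G y v (christoffel G y u w)

/-- The Ricci tensor, `Ric(v, w) = trace (u ↦ R(u, v) w)`. -/
def ricciCoord (G : Model n → (Model n →L[ℝ] Model n →L[ℝ] ℝ)) (y v w : Model n) : ℝ :=
  ∑ i, riemannCoord G y (EuclideanSpace.single i 1) v w i

end Coordinates

section Curvature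

variable {n m : ℕ} {M : Type u} [TopologicalSpace M] [ChartedSpace (Model n) M]
  {N : Type v} [TopologicalSpace N] [ChartedSpace (Model m) N]

/-- The Christoffel symbols of the metric `g` at `x`, in the preferred chart around `x`.
(The tangent space at `x` is identified with `ℝⁿ` through this chart.) -/
def christoffelAt (g : TwoTensor n M) (x : M) (u v : TangentSpace (𝓡 n) x) :
    TangentSpace (𝓡 n) x :=
  christoffel (coordRep g x) (extChartAt (𝓡 n) x x) u v

/-- The Ricci tensor of the metric `g`. -/
def ricci (g : TwoTensor n M) (x : M) (v w : TangentSpace (𝓡 n) x) : ℝ :=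
  ricciCoord (coordRep g x) (extChartAt (𝓡 n) x x) v w

/-- The covariant derivative `(∇_a k)(b, c)` of a 2-tensor `k`, for the Levi-Civita connection
of `g`. -/
def covDerivTensor (g k : TwoTensor n M) (x : M) (a b c : TangentSpace (𝓡 n) x) : ℝ :=
  fderiv ℝ (coordRep k x) (extChartAt (𝓡 n) x x) a b c
    - k x (christoffelAt g x a b) c - k x b (christoffelAt g x a c)

/-- The covariant derivative `∇_u Z` of a vector field `Z` along a map `f : N → M`, for the
Levi-Civita connection of `g`: in the preferred chart around `f p`, it is the derivative of the
components of `Z` in the direction `u`, plus `Γ(df u, Z)`. -/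
def covDerivAlong (g : TwoTensor n M) (f : N → M) (Z : ∀ q : N, TangentSpace (𝓡 n) (f q))
    (p : N) (u : TangentSpace (𝓡 m) p) : TangentSpace (𝓡 n) (f p) :=
  mvfderiv (𝓡 m) (fun q ↦ mvfderiv (𝓡 n) (extChartAt (𝓡 n) (f p)) (f q) (Z q)) p u
    + christoffel (coordRep g (f p)) (extChartAt (𝓡 n) (f p) (f p))
        (mfderiv (𝓡 m) (𝓡 n) f p u) (Z p)

/-- The coordinate basis of the tangent space at `x`. -/
def basisVec (x : M) (i : Fin n) : TangentSpace (𝓡 n) x :=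
  (EuclideanSpace.single i 1 : Model n)

/-- The trace `g^{ij} B_{ij}` with respect to the metric `g` at `x`. -/
def metricTrace (g : TwoTensor n M) (x : M)
    (B : TangentSpace (𝓡 n) x → TangentSpace (𝓡 n) x → ℝ) : ℝ :=
  ∑ i, ∑ j, (Matrix.of fun a b ↦ g x (basisVec x a) (basisVec x b))⁻¹ i j
    * B (basisVec x i) (basisVec x j)

end Curvature

/-! ### Vacuum initial data -/

/-- Smooth vacuum initial data on the 3-manifold `S`: a Riemannian metric `metric` and a symmetric
2-tensor `k`, both smooth, satisfying the vacuum constraints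
`R - Tr(k²) + Tr(k)² = 0` and `∇_j k_i^j - ∇_i Tr(k) = 0`. -/
structure InitialData (S : Type v) [TopologicalSpace S] [ChartedSpace (Model 3) S]
    [IsManifold (𝓡 3) ∞ S] where
  metric : Bundle.ContMDiffRiemannianMetric (𝓡 3) ∞ (Model 3)
    (fun x : S ↦ TangentSpace (𝓡 3) x)
  k : TwoTensor 3 S
  k_smooth : IsSmoothTensor k
  k_symm : ∀ x u w, k x u w = k x w u
  hamiltonian : ∀ x,
    metricTrace metric.inner x (fun u w ↦ ricci (n := 3) metric.inner x u w)
      - metricTrace metric.inner x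
          (fun u w ↦ metricTrace metric.inner x (fun a b ↦ k x u a * k x b w))
      + (metricTrace metric.inner x (fun u w ↦ k x u w)) ^ 2 = 0
  momentum : ∀ x (v : TangentSpace (𝓡 3) x),
    metricTrace metric.inner x (fun a b ↦ covDerivTensor (n := 3) metric.inner k x a b v)
      - mvfderiv (𝓡 3) (fun y ↦ metricTrace metric.inner y (fun u w ↦ k y u w)) x v = 0

/-! ### Spacetimes -/

section Spacetime

variable {M : Type u} [TopologicalSpace M] [ChartedSpace (Model 4) M]
  {M' : Type u} [TopologicalSpace M'] [ChartedSpace (Model 4) M']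

/-- A smooth Lorentzian metric of signature `(-, +, +, +)`. -/
structure IsLorentzian [IsManifold (𝓡 4) ∞ M] (g : TwoTensor 4 M) : Prop where
  smooth : IsSmoothTensor g
  symm : ∀ x u w, g x u w = g x w u
  signature : ∀ x, ∃ b : Module.Basis (Fin 4) ℝ (TangentSpace (𝓡 4) x),
    ∀ i j, g x (b i) (b j) = Matrix.diagonal ![-1, 1, 1, 1] i j

/-- `T` defines a time orientation for `g`: it is a smooth global timelike vector field. -/
structure IsTimeOrientation [IsManifold (𝓡 4) ∞ M] (g : TwoTensor 4 M) (T : VField 4 M) :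
    Prop where
  smooth : IsSmoothField T
  timelike : ∀ x, g x (T x) (T x) < 0

/-- `w` is a future-directed causal vector at `x` for the time orientation defined by `T`. -/
def IsFutureDirected (g : TwoTensor 4 M) (T : VField 4 M) (x : M) (w : TangentSpace (𝓡 4) x) :
    Prop :=
  g x w w ≤ 0 ∧ g x w (T x) < 0

/-- `f : (M', g', T') → (M, g, T)` preserves time orientation: its derivative maps future-directed
causal vectors to future-directed causal vectors. -/
def PreservesTimeOrientation (f : M' → M) (g' : TwoTensor 4 M') (T' : VField 4 M')
    (g : TwoTensor 4 M) (T : VField 4 M) : Prop :=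
  ∀ (x : M') (w : TangentSpace (𝓡 4) x), IsFutureDirected g' T' x w →
    IsFutureDirected g T (f x) (mfderiv (𝓡 4) (𝓡 4) f x w)

/-- An inextendible smooth timelike curve. Its domain, an open interval, is taken to be all of
`ℝ`, which is no restriction; inextendibility means that it has no endpoint in `M`. -/
structure IsInextendibleTimelikeCurve (g : TwoTensor 4 M) (γ : ℝ → M) : Prop where
  smooth : ContMDiff 𝓘(ℝ, ℝ) (𝓡 4) ∞ γ
  timelike : ∀ t : ℝ, 
    g (γ t) (mfderiv 𝓘(ℝ, ℝ) (𝓡 4) γ t (1 : ℝ)) (mfderiv 𝓘(ℝ, ℝ) (𝓡 4) γ t (1 : ℝ)) < 0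
  no_future_endpoint : ∀ p, ¬ Tendsto γ atTop (𝓝 p)
  no_past_endpoint : ∀ p, ¬ Tendsto γ atBot (𝓝 p)

/-- `A` is a Cauchy surface of `(M, g)`: every inextendible timelike curve meets `A` exactly
once. -/
def IsCauchySurface (g : TwoTensor 4 M) (A : Set M) : Prop :=
  ∀ γ : ℝ → M, IsInextendibleTimelikeCurve g γ → ∃! t : ℝ, γ t ∈ A

end Spacetime

/-! ### Developments of initial data -/

section Developments

variable {S : Type v} [TopologicalSpace S] [ChartedSpace (Model 3) S] [IsManifold (𝓡 3) ∞ S]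

/-- `k` is the extrinsic curvature of `ι(S)` in `(M, g)`, pulled back to `S` by `ι`:
`k(X, Y) = - g(∇_X N, Y)`, where `N` is the future-directed unit normal vector field along `ι`. -/
def IsExtrinsicCurvature {M : Type u} [TopologicalSpace M] [ChartedSpace (Model 4) M]
    (g : TwoTensor 4 M) (T : VField 4 M) (ι : S → M) (k : TwoTensor 3 S) : Prop :=
  ∃ N : ∀ p : S, TangentSpace (𝓡 4) (ι p),
    (∀ p, IsFutureDirected g T (ι p) (N p) ∧ g (ι p) (N p) (N p) = -1 ∧
      ∀ u : TangentSpace (𝓡 3) p, g (ι p) (N p) (mfderiv (𝓡 3) (𝓡 4) ι p u) = 0) ∧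
    ∀ (p : S) (u w : TangentSpace (𝓡 3) p),
      k p u w = - g (ι p) (covDerivAlong g ι N p u) (mfderiv (𝓡 3) (𝓡 4) ι p w)

/-- `(M, g, ι)`, with the time orientation given by `T`, is a Cauchy development (globally
hyperbolic development) of the initial data `D`: `(M, g)` is a time-oriented Lorentzian manifold
with vanishing Ricci tensor, and `ι` is an embedding onto a Cauchy surface on which `g` induces
the given metric (so that `ι(S)` is spacelike) and the given extrinsic curvature. -/
structure IsDevelopment (D : InitialData S)
    {M : Type u} [TopologicalSpace M] [ChartedSpace (Model 4) M] [IsManifold (𝓡 4) ∞ M]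
    (g : TwoTensor 4 M) (T : VField 4 M) (ι : S → M) : Prop where
  lorentzian : IsLorentzian g
  timeOrientation : IsTimeOrientation g T
  ricci_eq_zero : ∀ x v w, ricci g x v w = 0
  embedding : Manifold.IsSmoothEmbedding (𝓡 3) (𝓡 4) ∞ ι
  cauchy : IsCauchySurface g (range ι)
  induced_metric : pullback ι g = D.metric.inner
  extrinsic_curvature : IsExtrinsicCurvature g T ι D.k

/-- `(M, g, ι)`, with the time orientation given by `T`, is a maximal globally hyperbolic
development of the initial data `D`: it is a development, and every development
`(M', g', ι')` of `D`, on any spacetime manifold `M'`, admits an embedding `θ : M' → M` that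
preserves time orientation and satisfies `θ^* g = g'` and `θ ∘ ι' = ι`. -/
def IsMGHD (D : InitialData S)
    {M : Type u} [TopologicalSpace M] [ChartedSpace (Model 4) M] [IsManifold (𝓡 4) ∞ M]
    (g : TwoTensor 4 M) (T : VField 4 M) (ι : S → M) : Prop :=
  IsDevelopment D g T ι ∧
    ∀ (M' : Type u) [TopologicalSpace M'] [ChartedSpace (Model 4) M'] [IsManifold (𝓡 4) ∞ M']
      [T2Space M'] [SecondCountableTopology M'] [ConnectedSpace M']
      (g' : TwoTensor 4 M') (T' : VField 4 M') (ι' : S → M'), IsDevelopment D g' T' ι' →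
      ∃ θ : M' → M, Manifold.IsSmoothEmbedding (𝓡 4) (𝓡 4) ∞ θ ∧ pullback θ g = g' ∧
        θ ∘ ι' = ι ∧ PreservesTimeOrientation θ g' T' g T

end Developments

end GR

end

/-!
The proposition says that the notion of a maximal globally hyperbolic development is invariant under
diffeomorphisms `ψ` that fix a neighbourhood of the Cauchy surface.

The map `ψ : (M, ψ^* g) → (M, g)` is an isometry, so everything that can be expressed through the
metric alone is carried over. The signature and smoothness pull back directly. For the Ricci tensor,
which is defined through preferred charts, one has to show that it is a tensor: for a local
diffeomorphism `F` of `ℝⁿ`, the Christoffel symbols of `F^* G` and `G` are related by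
`DF(Γ'(u, v)) = Γ(DF u, DF v) + D²F(u, v)` (`fderiv_christoffelMap_flatPullback`). Differentiating
this law and antisymmetrizing gives the tensor law for the curvature
(`fderiv_riemannMap_flatPullback`), and the trace is invariant under conjugation
(`ricciCoord_flatPullback`). In the preferred charts, pulling back by `ψ` is pulling back by its
coordinate representation (`coordRep_pullback`); this yields `ricci_pullback`, and also the
smoothness of `ψ^* g`. A timelike curve `γ` for `ψ^* g` is inextendible iff `ψ ∘ γ` is for `g`, and
both meet `ι(S)` at the same parameters, since `ψ` and `ψ⁻¹` fix `ι(S)` pointwise.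

Near `ι(S)` the map `ψ` is the identity, so `ψ^* g` and `g` have the same germ there, and the
induced metric and the extrinsic curvature are unchanged. What has to be checked is that the unit normal is
future-directed for the new time orientation `T'`. The hypothesis says only that `dψ` maps
`T'`-future vectors to `T`-future vectors; the converse (`isFutureDirected_of_mfderiv`) follows from
the fact that two `T`-future vectors, one causal and one timelike, have negative inner product
(`lorentz_inner_neg`), applied to `dψ w` and `dψ T'`. The same converse shows that, for a
development with embedding `θ` into `(M, g)`, the embedding `ψ⁻¹ ∘ θ` into `(M, ψ^* g)` preserves time
orientation, which gives maximality.
-/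

noncomputable section

namespace GR

universe u v

/-! ### Lorentzian linear algebra -/

section Lorentz

variable {V : Type*} [AddCommGroup V] [Module ℝ V]

/-- In a Lorentzian vector space, a causal vector and a timelike vector that are both
future-directed with respect to a timelike vector `t` have negative inner product. In an
orthonormal frame this is the reversed Cauchy-Schwarz inequality. -/
theorem lorentz_inner_neg (B : V → V → ℝ) (b : Module.Basis (Fin 4) ℝ V)
    (hB : ∀ v w, B v w = -(b.repr v 0 * b.repr w 0) + b.repr v 1 * b.repr w 1
      + b.repr v 2 * b.repr w 2 + b.repr v 3 * b.repr w 3) {a c t : V}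
    (ha : B a a ≤ 0) (hc : B c c < 0) (ht : B t t < 0) (hat : B a t < 0) (hct : B c t < 0) :
    B a c < 0 := by
  rw [hB] at *
  generalize b.repr a 0 = a0 at *
  generalize b.repr a 1 = a1 at *
  generalize b.repr a 2 = a2 at *
  generalize b.repr a 3 = a3 at *
  generalize b.repr c 0 = c0 at *
  generalize b.repr c 1 = c1 at *
  generalize b.repr c 2 = c2 at *
  generalize b.repr c 3 = c3 at *
  generalize b.repr t 0 = t0 at *
  generalize b.repr t 1 = t1 at *
  generalize b.repr t 2 = t2 at *
  generalize b.repr t 3 = t3 at *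
  -- the Cauchy-Schwarz inequality for the spatial parts
  have cs (x1 x2 x3 y1 y2 y3 : ℝ) : (x1 * y1 + x2 * y2 + x3 * y3) ^ 2 ≤
      (x1 ^ 2 + x2 ^ 2 + x3 ^ 2) * (y1 ^ 2 + y2 ^ 2 + y3 ^ 2) := by
    nlinarith [sq_nonneg (x1 * y2 - x2 * y1), sq_nonneg (x1 * y3 - x3 * y1),
      sq_nonneg (x2 * y3 - x3 * y2)]
  -- the time components of a causal and a timelike vector dominate the spatial inner product
  have key (x0 x1 x2 x3 y0 y1 y2 y3 : ℝ) (hx : x1 ^ 2 + x2 ^ 2 + x3 ^ 2 ≤ x0 ^ 2)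
      (hy : y1 ^ 2 + y2 ^ 2 + y3 ^ 2 < y0 ^ 2) :
      |x1 * y1 + x2 * y2 + x3 * y3| ≤ |x0 * y0| ∧
      (x0 ≠ 0 → |x1 * y1 + x2 * y2 + x3 * y3| < |x0 * y0|) := by
    have h1 := cs x1 x2 x3 y1 y2 y3
    have h2 : (x1 ^ 2 + x2 ^ 2 + x3 ^ 2) * (y1 ^ 2 + y2 ^ 2 + y3 ^ 2) ≤
        x0 ^ 2 * (y1 ^ 2 + y2 ^ 2 + y3 ^ 2) := by gcongr
    constructor
    · apply sq_le_sq.1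
      calc _ ≤ _ := h1
        _ ≤ _ := h2
        _ ≤ x0 ^ 2 * y0 ^ 2 := by gcongr
        _ = _ := by ring
    · intro h0
      apply sq_lt_sq.1
      calc _ ≤ _ := h1
        _ ≤ _ := h2
        _ < x0 ^ 2 * y0 ^ 2 := by
          have : 0 < x0 ^ 2 := by positivity
          gcongr
        _ = _ := by ring
  -- future-directed vectors have a time component of the same sign as that of `t`
  have sat : 0 < a0 * t0 := by
    by_contra! h
    have := (key a0 a1 a2 a3 t0 t1 t2 t3 (by linarith) (by linarith)).1
    rw [abs_of_nonpos h] at this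
    have := neg_abs_le (a1 * t1 + a2 * t2 + a3 * t3)
    linarith
  have sct : 0 < c0 * t0 := by
    by_contra! h
    have := (key c0 c1 c2 c3 t0 t1 t2 t3 (by linarith) (by linarith)).1
    rw [abs_of_nonpos h] at this
    have := neg_abs_le (c1 * t1 + c2 * t2 + c3 * t3)
    linarith
  have sac : 0 < a0 * c0 := by
    have h : 0 < (a0 * c0) * t0 ^ 2 := by nlinarith
    exact pos_of_mul_pos_left h (sq_nonneg _)
  have := (key a0 a1 a2 a3 c0 c1 c2 c3 (by linarith) (by linarith)).2 (by rintro rfl; simp at sac)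
  rw [abs_of_pos sac] at this
  have := le_abs_self (a1 * c1 + a2 * c2 + a3 * c3)
  linarith

end Lorentz

/-! ### Transformation of the curvature under a local diffeomorphism of a vector space -/

section Flat

-- needed for the instances on iterated spaces of continuous linear maps
set_option maxSynthPendingDepth 3

variable {E : Type*} [NormedAddCommGroup E] [NormedSpace ℝ E] {G : E → (E →L[ℝ] E →L[ℝ] ℝ)}
  {F : E → E} {y : E}

/-- The pullback of a field of bilinear forms on a vector space, with the derivative of `F` taken
as `fderiv`. -/
def flatPullback (F : E → E) (G : E → (E →L[ℝ] E →L[ℝ] ℝ)) : E → (E →L[ℝ] E →L[ℝ] ℝ) := fun z ↦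
  ((ContinuousLinearMap.compL ℝ E E ℝ).flip (fderiv ℝ F z)) ∘L G (F z) ∘L fderiv ℝ F z

@[simp]
theorem flatPullback_apply (z u v : E) :
    flatPullback F G z u v = G (F z) (fderiv ℝ F z u) (fderiv ℝ F z v) := rfl

theorem contDiffAt_flatPullback {m k : ℕ∞ω} (hF : ContDiffAt ℝ m F y)
    (hG : ContDiffAt ℝ k G (F y)) (hkm : k + 1 ≤ m) : ContDiffAt ℝ k (flatPullback F G) y := by
  have hD : ContDiffAt ℝ k (fderiv ℝ F) y := hF.fderiv_right hkm
  have hGF : ContDiffAt ℝ k (fun z ↦ G (F z)) y := hG.comp y (hF.of_le (le_self_add.trans hkm))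
  exact ((ContinuousLinearMap.contDiff _).contDiffAt.comp y hD).clm_comp (hGF.clm_comp hD)

/-- The Christoffel symbols as a field of continuous bilinear maps. For `E = ℝⁿ`, the vector
`christoffelMap G y u v` is by definition `christoffel G y u v`. -/
def christoffelMap (G : E → (E →L[ℝ] E →L[ℝ] ℝ)) (y : E) : E →L[ℝ] E →L[ℝ] E :=
  ContinuousLinearMap.compL ℝ E (E →L[ℝ] ℝ) E (G y).inverse ∘L
    ((1 / 2 : ℝ) • (fderiv ℝ G y + (fderiv ℝ G y).flip -
      ((ContinuousLinearMap.flipₗᵢ ℝ E E ℝ : (E →L[ℝ] E →L[ℝ] ℝ) ≃ₗᵢ[ℝ] _).toContinuousLinearEquiv :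
        (E →L[ℝ] E →L[ℝ] ℝ) →L[ℝ] (E →L[ℝ] E →L[ℝ] ℝ)) ∘L (fderiv ℝ G y).flip))

theorem christoffelMap_apply (y u v : E) : christoffelMap G y u v = (G y).inverse
    ((1 / 2 : ℝ) • (fderiv ℝ G y u v + fderiv ℝ G y v u - ((fderiv ℝ G y).flip u).flip v)) :=
  rfl

theorem contDiffAt_christoffelMap [CompleteSpace E] {m k : ℕ∞ω} (hG : ContDiffAt ℝ m G y)
    (hi : (G y).IsInvertible) (hkm : k + 1 ≤ m) : ContDiffAt ℝ k (christoffelMap G) y := by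
  have hD : ContDiffAt ℝ k (fderiv ℝ G) y := hG.fderiv_right hkm
  have hinv := (hi.contDiffAt_map_inverse (n := k)).comp y (hG.of_le (le_self_add.trans hkm))
  have hflip : ContDiffAt ℝ k (fun z ↦ (fderiv ℝ G z).flip) y :=
    (ContinuousLinearMap.flipₗᵢ ℝ E E (E →L[ℝ] ℝ)).contDiff.contDiffAt.comp y hD
  exact ((ContinuousLinearMap.contDiff _).contDiffAt.comp y hinv).clm_comp
    (((hD.add hflip).sub (contDiffAt_const.clm_comp hflip)).const_smul (1 / 2 : ℝ))

/-- The Koszul formula. -/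
theorem apply_christoffelMap (hi : (G y).IsInvertible) (u v w : E) :
    G y (christoffelMap G y u v) w =
      (fderiv ℝ G y u v w + fderiv ℝ G y v u w - fderiv ℝ G y w u v) / 2 := by
  rw [christoffelMap_apply, hi.self_apply_inverse]
  simp
  ring

theorem fderiv_flatPullback (hF : ContDiffAt ℝ 2 F y) (hG : ContDiffAt ℝ 1 G (F y))
    (u v w : E) :
    fderiv ℝ (flatPullback F G) y u v w =
      fderiv ℝ G (F y) (fderiv ℝ F y u) (fderiv ℝ F y v) (fderiv ℝ F y w)
      + G (F y) (fderiv ℝ (fderiv ℝ F) y u v) (fderiv ℝ F y w)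
      + G (F y) (fderiv ℝ F y v) (fderiv ℝ (fderiv ℝ F) y u w) := by
  have hD : ContDiffAt ℝ 1 (fderiv ℝ F) y := hF.fderiv_right (by norm_num)
  have hP := ((contDiffAt_flatPullback hF hG (by norm_num)).differentiableAt
    (by simp)).hasFDerivAt
  have hP' := (hP.clm_apply (hasFDerivAt_const v y)).clm_apply (hasFDerivAt_const w y)
  have h1 := (hG.differentiableAt (by simp)).hasFDerivAt.comp y
    (hF.differentiableAt (by simp)).hasFDerivAt
  have hD' := (hD.differentiableAt (by simp)).hasFDerivAt
  have h2 := (h1.clm_apply (hD'.clm_apply (hasFDerivAt_const v y))).clm_apply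
    (hD'.clm_apply (hasFDerivAt_const w y))
  have := congr($(hP'.unique h2) u)
  simp at this
  rw [this]
  ring

/-- The inhomogeneous transformation law of the Christoffel symbols. -/
theorem fderiv_christoffelMap_flatPullback (hF : ContDiffAt ℝ 2 F y)
    (hG : ContDiffAt ℝ 1 G (F y)) (hFi : (fderiv ℝ F y).IsInvertible)
    (hGi : (G (F y)).IsInvertible) (hPi : (flatPullback F G y).IsInvertible)
    (hs : ∀ᶠ z in 𝓝 (F y), ∀ u v, G z u v = G z v u) (u v : E) :
    fderiv ℝ F y (christoffelMap (flatPullback F G) y u v) =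
      christoffelMap G (F y) (fderiv ℝ F y u) (fderiv ℝ F y v)
        + fderiv ℝ (fderiv ℝ F) y u v := by
  have hsymm (u v : E) : fderiv ℝ (fderiv ℝ F) y u v = fderiv ℝ (fderiv ℝ F) y v u :=
    (hF.isSymmSndFDerivAt (by simp [minSmoothness_of_isRCLikeNormedField])).eq u v
  have hGs := hs.self_of_nhds
  apply hGi.injective
  ext w'
  obtain ⟨w, rfl⟩ := hFi.surjective w'
  have h1 := apply_christoffelMap hPi u v w
  rw [flatPullback_apply] at h1
  rw [h1, map_add, add_apply, apply_christoffelMap hGi,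
    fderiv_flatPullback hF hG, fderiv_flatPullback hF hG, fderiv_flatPullback hF hG,
    hsymm v u, hsymm w u, hsymm w v, hGs (fderiv ℝ F y v), hGs (fderiv ℝ F y u)]
  ring

theorem fderiv_christoffelMap_apply [CompleteSpace E] (hG : ContDiffAt ℝ 2 G y)
    (hi : (G y).IsInvertible) (u v w : E) :
    fderiv ℝ (fun z ↦ christoffelMap G z v w) y u = fderiv ℝ (christoffelMap G) y u v w := by
  have h := ((contDiffAt_christoffelMap hG hi (k := 1) (by norm_num)).differentiableAt
    (by simp)).hasFDerivAt
  simp [((h.clm_apply (hasFDerivAt_const v y)).clm_apply (hasFDerivAt_const w y)).fderiv]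

/-- The curvature as a field of trilinear maps, `riemannMap G y u v w = R(u, v) w`. -/
def riemannMap (G : E → (E →L[ℝ] E →L[ℝ] ℝ)) (y u v w : E) : E :=
  fderiv ℝ (christoffelMap G) y u v w - fderiv ℝ (christoffelMap G) y v u w
    + christoffelMap G y u (christoffelMap G y v w)
    - christoffelMap G y v (christoffelMap G y u w)

/-- The curvature is a tensor: differentiating the transformation law of the Christoffel symbols
once more and antisymmetrizing, all terms with second and third derivatives of `F` cancel. -/
theorem fderiv_riemannMap_flatPullback [CompleteSpace E] (hF : ContDiffAt ℝ 3 F y)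
    (hG : ContDiffAt ℝ 2 G (F y)) (hFi : (fderiv ℝ F y).IsInvertible)
    (hGi : (G (F y)).IsInvertible) (hPi : (flatPullback F G y).IsInvertible)
    (hs : ∀ᶠ z in 𝓝 (F y), ∀ u v, G z u v = G z v u) (u v w : E) :
    fderiv ℝ F y (riemannMap (flatPullback F G) y u v w) =
      riemannMap G (F y) (fderiv ℝ F y u) (fderiv ℝ F y v) (fderiv ℝ F y w) := by
  have hD : ContDiffAt ℝ 2 (fderiv ℝ F) y := hF.fderiv_right (by norm_num)
  have hDD : ContDiffAt ℝ 1 (fderiv ℝ (fderiv ℝ F)) y := hD.fderiv_right (by norm_num)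
  have hP := contDiffAt_flatPullback hF hG (by norm_num)
  have hsymm (u v : E) : fderiv ℝ (fderiv ℝ F) y u v = fderiv ℝ (fderiv ℝ F) y v u :=
    ((hF.of_le (by norm_num)).isSymmSndFDerivAt
      (n := 2) (by simp [minSmoothness_of_isRCLikeNormedField])).eq u v
  have hsymm3 (u v w : E) : fderiv ℝ (fderiv ℝ (fderiv ℝ F)) y u v w =
      fderiv ℝ (fderiv ℝ (fderiv ℝ F)) y v u w :=
    congr($((hD.isSymmSndFDerivAt (by simp [minSmoothness_of_isRCLikeNormedField])).eq u v) w)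
  have open_inv : ∀ L : E →L[ℝ] E, L.IsInvertible → ∀ᶠ K in 𝓝 L, K.IsInvertible := by
    rintro _ ⟨e, rfl⟩
    exact e.nhds
  have open_inv' : ∀ L : E →L[ℝ] E →L[ℝ] ℝ, L.IsInvertible → ∀ᶠ K in 𝓝 L, K.IsInvertible := by
    rintro _ ⟨e, rfl⟩
    exact e.nhds
  have law : ∀ᶠ z in 𝓝 y, ∀ u v, fderiv ℝ F z (christoffelMap (flatPullback F G) z u v) =
      christoffelMap G (F z) (fderiv ℝ F z u) (fderiv ℝ F z v)
        + fderiv ℝ (fderiv ℝ F) z u v := by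
    filter_upwards [hF.eventually (by simp), hF.continuousAt.eventually (hG.eventually (by simp)),
      hD.continuousAt.eventually (open_inv _ hFi),
      (hG.continuousAt.comp (f := F) hF.continuousAt).eventually (open_inv' _ hGi),
      hP.continuousAt.eventually (open_inv' _ hPi),
      hF.continuousAt.eventually hs.eventually_nhds] with z h1 h2 h3 h4 h5 h6 u v
    exact fderiv_christoffelMap_flatPullback (h1.of_le (by norm_num)) (h2.of_le (by norm_num))
      h3 h4 h5 h6 u v
  have hD' := (hD.differentiableAt (by simp)).hasFDerivAt
  have hDD' := (hDD.differentiableAt (by simp)).hasFDerivAt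
  have hΓ := ((contDiffAt_christoffelMap hG hGi (k := 1) (by norm_num)).differentiableAt
    (by simp)).hasFDerivAt.comp y
    (hF.differentiableAt (by simp)).hasFDerivAt
  have hΓ' := ((contDiffAt_christoffelMap hP hPi (k := 1) (by norm_num)).differentiableAt
    (by simp)).hasFDerivAt
  -- the derivative of the transformation law
  have dlaw (u v w : E) := by
    have hl := hD'.clm_apply
      ((hΓ'.clm_apply (hasFDerivAt_const v y)).clm_apply (hasFDerivAt_const w y))
    have hr := ((hΓ.clm_apply (hD'.clm_apply (hasFDerivAt_const v y))).clm_apply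
      (hD'.clm_apply (hasFDerivAt_const w y))).add
      ((hDD'.clm_apply (hasFDerivAt_const v y)).clm_apply (hasFDerivAt_const w y))
    have h := congr($(hl.unique (hr.congr_of_eventuallyEq (law.mono fun z hz ↦ hz v w))) u)
    simpa using h
  have l := law.self_of_nhds
  have e1 := dlaw u v w
  have e2 := dlaw v u w
  simp only [riemannMap, map_add, map_sub, l] at e1 e2 ⊢
  rw [eq_sub_of_add_eq e1, eq_sub_of_add_eq e2, hsymm v u, hsymm3 v u]
  abel

/-- The map `u ↦ R(u, v) w`, whose trace is the Ricci tensor. -/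
def riemannEnd (G : E → (E →L[ℝ] E →L[ℝ] ℝ)) (y v w : E) : E →ₗ[ℝ] E where
  toFun u := riemannMap G y u v w
  map_add' a b := by simp [riemannMap]; abel
  map_smul' c a := by simp [riemannMap, smul_sub, smul_add]

theorem trace_riemannEnd_flatPullback [CompleteSpace E] (hF : ContDiffAt ℝ 3 F y)
    (hG : ContDiffAt ℝ 2 G (F y)) (hFi : (fderiv ℝ F y).IsInvertible)
    (hGi : (G (F y)).IsInvertible) (hPi : (flatPullback F G y).IsInvertible)
    (hs : ∀ᶠ z in 𝓝 (F y), ∀ u v, G z u v = G z v u) (v w : E) :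
    LinearMap.trace ℝ E (riemannEnd (flatPullback F G) y v w) =
      LinearMap.trace ℝ E (riemannEnd G (F y) (fderiv ℝ F y v) (fderiv ℝ F y w)) := by
  have h := fderiv_riemannMap_flatPullback hF hG hFi hGi hPi hs
  obtain ⟨e, he⟩ := hFi
  rw [← LinearMap.trace_conj' _ e.toLinearEquiv]
  congr 1
  ext u
  obtain ⟨u, rfl⟩ := e.surjective u
  simpa [LinearEquiv.conj_apply, riemannEnd, ← he] using h u v w

end Flat

/-! ### The Ricci tensor in coordinates -/

section Coordinates

variable {n : ℕ} {G : Model n → (Model n →L[ℝ] Model n →L[ℝ] ℝ)} {F : Model n → Model n}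
  {y : Model n}

theorem riemannCoord_eq_riemannMap (hG : ContDiffAt ℝ 2 G y) (hi : (G y).IsInvertible)
    (u v w : Model n) : riemannCoord G y u v w = riemannMap G y u v w := by
  change fderiv ℝ (fun z ↦ christoffelMap G z v w) y u
    - fderiv ℝ (fun z ↦ christoffelMap G z u w) y v + christoffelMap G y u (christoffelMap G y v w)
    - christoffelMap G y v (christoffelMap G y u w) = _
  rw [fderiv_christoffelMap_apply hG hi, fderiv_christoffelMap_apply hG hi, riemannMap]

theorem ricciCoord_eq_trace (hG : ContDiffAt ℝ 2 G y) (hi : (G y).IsInvertible)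
    (v w : Model n) : ricciCoord G y v w = LinearMap.trace ℝ _ (riemannEnd G y v w) := by
  rw [LinearMap.trace_eq_matrix_trace ℝ (EuclideanSpace.basisFun (Fin n) ℝ).toBasis]
  simp [ricciCoord, Matrix.trace, LinearMap.toMatrix_apply, riemannEnd,
    riemannCoord_eq_riemannMap hG hi]

theorem ricciCoord_flatPullback (hF : ContDiffAt ℝ 3 F y)
    (hG : ContDiffAt ℝ 2 G (F y)) (hFi : (fderiv ℝ F y).IsInvertible)
    (hGi : (G (F y)).IsInvertible) (hPi : (flatPullback F G y).IsInvertible)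
    (hs : ∀ᶠ z in 𝓝 (F y), ∀ u v, G z u v = G z v u) (v w : Model n) :
    ricciCoord (flatPullback F G) y v w =
      ricciCoord G (F y) (fderiv ℝ F y v) (fderiv ℝ F y w) := by
  rw [ricciCoord_eq_trace hG hGi,
    ricciCoord_eq_trace (contDiffAt_flatPullback hF hG (by norm_num)) hPi,
    trace_riemannEnd_flatPullback hF hG hFi hGi hPi hs]

end Coordinates

/-! ### Smooth tensor fields in charts -/

section Charts

variable {n : ℕ} {M : Type u} [TopologicalSpace M] [ChartedSpace (Model n) M]
  [IsManifold (𝓡 n) ∞ M]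
  {N : Type v} [TopologicalSpace N] [ChartedSpace (Model n) N] [IsManifold (𝓡 n) ∞ N]

set_option maxSynthPendingDepth 3

omit [IsManifold (𝓡 n) ∞ M] in
/-- All tangent spaces are definitionally the model space, so that tangent vectors can be moved
between equal base points without a cast. -/
theorem apply_congr_point (g : TwoTensor n M) {p q : M} (h : p = q) (u v : Model n) :
    g p u v = g q u v := by
  subst h; rfl

theorem isInvertible_mfderiv_extChartAt_symm' {x : M} {z : Model n}
    (hz : z ∈ (extChartAt (𝓡 n) x).target) :
    (mfderiv (𝓡 n) (𝓡 n) (extChartAt (𝓡 n) x).symm z).IsInvertible := by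
  have : IsManifold (𝓡 n) 1 M := .of_le (n := ∞) (by simp)
  simpa using isInvertible_mfderivWithin_extChartAt_symm hz

theorem mdifferentiableAt_extChartAt_symm' {x : M} {z : Model n}
    (hz : z ∈ (extChartAt (𝓡 n) x).target) :
    MDifferentiableAt (𝓡 n) (𝓡 n) (extChartAt (𝓡 n) x).symm z := by
  have : IsManifold (𝓡 n) 1 M := .of_le (n := ∞) (by simp)
  have h := mdifferentiableWithinAt_extChartAt_symm hz
  rwa [ModelWithCorners.range_eq_univ, mdifferentiableWithinAt_univ] at h

/-- A tensor field is smooth iff its components in every preferred chart are smooth at the centre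
of that chart. -/
theorem isSmoothTensor_iff_coordRep {g : TwoTensor n M} :
    IsSmoothTensor g ↔ ∀ x, ContDiffAt ℝ ∞ (coordRep g x) (extChartAt (𝓡 n) x x) := by
  refine forall_congr' fun x ↦ ?_
  rw [contMDiffAt_hom_bundle]
  have : IsManifold (𝓡 n) 1 M := .of_le (n := ∞) (by simp)
  have h : (fun y ↦ ContinuousLinearMap.inCoordinates (Model n) (fun x : M ↦ TangentSpace (𝓡 n) x)
      (Model n →L[ℝ] ℝ) (fun x : M ↦ TangentSpace (𝓡 n) x →L[ℝ] ℝ) x y x y (g y)) =ᶠ[𝓝 x]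
      coordRep g x ∘ extChartAt (𝓡 n) x := by
    filter_upwards [(isOpen_extChartAt_source (I := 𝓡 n) x).mem_nhds (mem_extChartAt_source x)]
      with y hy
    have hy' : y ∈ (chartAt (Model n) x).source := by simpa using hy
    have hsymm (v : Model n) : (trivializationAt (Model n) (TangentSpace (𝓡 n)) x).symm y v =
        mfderiv (𝓡 n) (𝓡 n) (extChartAt (𝓡 n) x).symm (extChartAt (𝓡 n) x y) v := by
      have := congr($(TangentBundle.symmL_trivializationAt (I := 𝓡 n) hy') v)
      rw [ModelWithCorners.range_eq_univ, mfderivWithin_univ] at this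
      exact (Bundle.Trivialization.symmL_apply _ hy' v).symm.trans this
    ext u v
    -- the trivialization of the bundle of forms around `x` pulls back by `φ⁻¹`, like `coordRep`
    have key := inCoordinates_apply_eq₂ (𝕜 := ℝ) (E₁ := fun x : M ↦ TangentSpace (𝓡 n) x)
      (E₂ := fun x : M ↦ TangentSpace (𝓡 n) x) (F₁ := Model n) (F₂ := Model n) (F₃ := ℝ)
      (E₃ := fun _ : M ↦ ℝ) (x₀ := x) (x := y) (ϕ := g y) (v := u) (w := v) hy' hy' (by simp)
    have hl (r : ℝ) : (trivializationAt ℝ (fun _ : M ↦ ℝ) x).linearMapAt ℝ y r = r := by simp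
    rw [hsymm, hsymm, hl] at key
    exact key.trans (apply_congr_point g ((extChartAt (𝓡 n) x).left_inv hy).symm _ _)
  constructor
  · intro H
    have H1 := H.2.congr_of_eventuallyEq h.symm
    have h2 := (contMDiffAt_iff.1 H1).2
    rw [ModelWithCorners.range_eq_univ, contDiffWithinAt_univ] at h2
    refine h2.congr_of_eventuallyEq ?_
    filter_upwards [(isOpen_extChartAt_target (I := 𝓡 n) x).mem_nhds (mem_extChartAt_target x)]
      with z hz
    simp only [Function.comp_apply, (extChartAt (𝓡 n) x).right_inv hz]
    rfl
  · intro H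
    refine ⟨contMDiffAt_id, ContMDiffAt.congr_of_eventuallyEq ?_ h⟩
    exact H.contMDiffAt.comp x (contMDiffAt_extChartAt (I := 𝓡 n))

/-- In charts, the pullback of a tensor field by a map is the pullback by the coordinate
representation of that map. -/
theorem coordRep_pullback (g : TwoTensor n N) {f : M → N} (hf : ContMDiff (𝓡 n) (𝓡 n) ∞ f)
    (x : M) : coordRep (pullback f g) x =ᶠ[𝓝 (extChartAt (𝓡 n) x x)]
      flatPullback (extChartAt (𝓡 n) (f x) ∘ f ∘ (extChartAt (𝓡 n) x).symm)
        (coordRep g (f x)) := by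
  have ht := (isOpen_extChartAt_target (I := 𝓡 n) x).mem_nhds (mem_extChartAt_target x)
  have hc : ContinuousAt (f ∘ (extChartAt (𝓡 n) x).symm) (extChartAt (𝓡 n) x x) :=
    hf.continuous.continuousAt.comp (continuousAt_extChartAt_symm x)
  have hs : (extChartAt (𝓡 n) (f x)).source ∈
      𝓝 ((f ∘ (extChartAt (𝓡 n) x).symm) (extChartAt (𝓡 n) x x)) := by
    simpa using extChartAt_source_mem_nhds (I := 𝓡 n) (f x)
  filter_upwards [ht, (hc.eventually hs).eventually_nhds] with z hz hz'
  have hzs := hz'.self_of_nhds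
  set φ := extChartAt (𝓡 n) x
  set φ' := extChartAt (𝓡 n) (f x)
  have hφ := mdifferentiableAt_extChartAt_symm' hz
  have hf' : MDifferentiableAt (𝓡 n) (𝓡 n) f (φ.symm z) := hf.mdifferentiableAt (by simp)
  have hleft : φ'.symm ((φ' ∘ f ∘ φ.symm) z) = f (φ.symm z) := φ'.left_inv hzs
  have hF : MDifferentiableAt (𝓡 n) (𝓡 n) (φ' ∘ f ∘ φ.symm) z :=
    (mdifferentiableAt_extChartAt (by rw [← extChartAt_source (𝓡 n)]; exact hzs)).comp z
      (hf'.comp z hφ)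
  -- near `z`, both sides of the claim are pullbacks of `g` by the map `φ'⁻¹ ∘ F = f ∘ φ⁻¹`
  have heq : φ'.symm ∘ (φ' ∘ f ∘ φ.symm) =ᶠ[𝓝 z] f ∘ φ.symm :=
    hz'.mono fun z' h ↦ φ'.left_inv h
  have hcomp (u : Model n) :
      (mfderiv (𝓡 n) (𝓡 n) f (φ.symm z) (mfderiv (𝓡 n) (𝓡 n) φ.symm z u) : Model n) =
      mfderiv (𝓡 n) (𝓡 n) φ'.symm ((φ' ∘ f ∘ φ.symm) z) (fderiv ℝ (φ' ∘ f ∘ φ.symm) z u) := by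
    rw [← mfderiv_eq_fderiv]
    have h1 := congr($(mfderiv_comp z hf' hφ) u)
    have h2 := congr($(mfderiv_comp z
      (mdifferentiableAt_extChartAt_symm' (φ'.map_source hzs)) hF) u)
    have h3 := congr($(heq.mfderiv_eq (I := 𝓡 n) (I' := 𝓡 n)) u)
    exact h1.symm.trans (h3.symm.trans h2)
  ext u v
  rw [flatPullback_apply]
  change g (f (φ.symm z)) (mfderiv (𝓡 n) (𝓡 n) f (φ.symm z) (mfderiv (𝓡 n) (𝓡 n) φ.symm z u))
    (mfderiv (𝓡 n) (𝓡 n) f (φ.symm z) (mfderiv (𝓡 n) (𝓡 n) φ.symm z v)) =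
    g (φ'.symm ((φ' ∘ f ∘ φ.symm) z))
      (mfderiv (𝓡 n) (𝓡 n) φ'.symm ((φ' ∘ f ∘ φ.symm) z) (fderiv ℝ (φ' ∘ f ∘ φ.symm) z u))
      (mfderiv (𝓡 n) (𝓡 n) φ'.symm ((φ' ∘ f ∘ φ.symm) z) (fderiv ℝ (φ' ∘ f ∘ φ.symm) z v))
  refine (apply_congr_point g hleft.symm _ _).trans ?_
  rw [hcomp, hcomp]

omit [IsManifold (𝓡 n) ∞ M] [IsManifold (𝓡 n) ∞ N] in
theorem contDiffAt_writtenInCharts {f : M → N} (hf : ContMDiff (𝓡 n) (𝓡 n) ∞ f) (x : M) :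
    ContDiffAt ℝ ∞ (extChartAt (𝓡 n) (f x) ∘ f ∘ (extChartAt (𝓡 n) x).symm)
      (extChartAt (𝓡 n) x x) := by
  have h := (contMDiffAt_iff.1 (hf x)).2
  rwa [ModelWithCorners.range_eq_univ, contDiffWithinAt_univ] at h

theorem isSmoothTensor_pullback {g : TwoTensor n N} (hg : IsSmoothTensor g) {f : M → N}
    (hf : ContMDiff (𝓡 n) (𝓡 n) ∞ f) : IsSmoothTensor (n := n) (pullback f g) := by
  rw [isSmoothTensor_iff_coordRep (n := n)] at hg ⊢
  intro x
  refine ContDiffAt.congr_of_eventuallyEq ?_ (coordRep_pullback g hf x)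
  exact contDiffAt_flatPullback (contDiffAt_writtenInCharts hf x) (by simpa using hg (f x))
    (by simp)

/-- In finite dimension, a nondegenerate bilinear form is invertible as a map to the dual. -/
theorem isInvertible_of_nondegenerate {E : Type*} [NormedAddCommGroup E] [NormedSpace ℝ E]
    [FiniteDimensional ℝ E] (B : E →L[ℝ] E →L[ℝ] ℝ) (hB : ∀ u, (∀ v, B u v = 0) → u = 0) :
    B.IsInvertible := by
  have hinj : Function.Injective (B : E →ₗ[ℝ] E →L[ℝ] ℝ) := by
    refine (injective_iff_map_eq_zero _).2 fun u hu ↦ hB u fun v ↦ ?_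
    simpa using congr($hu v)
  have hd : Module.finrank ℝ E = Module.finrank ℝ (E →L[ℝ] ℝ) := by
    rw [← (LinearMap.toContinuousLinearMap : (E →ₗ[ℝ] ℝ) ≃ₗ[ℝ] _).finrank_eq]
    exact Subspace.dual_finrank_eq.symm
  exact ⟨(LinearEquiv.ofInjectiveOfFinrankEq _ hinj hd).toContinuousLinearEquiv, by ext; rfl⟩

theorem isInvertible_coordRep {g : TwoTensor n M} {x : M} {z : Model n}
    (hz : z ∈ (extChartAt (𝓡 n) x).target)
    (hg : ∀ u, (∀ v, g ((extChartAt (𝓡 n) x).symm z) u v = 0) → u = 0) :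
    (coordRep g x z).IsInvertible := by
  refine isInvertible_of_nondegenerate _ fun u hu ↦ ?_
  have hi := isInvertible_mfderiv_extChartAt_symm' hz
  refine hi.injective (Eq.trans (hg _ fun v ↦ ?_) (map_zero _).symm)
  obtain ⟨v, rfl⟩ := hi.surjective v
  exact hu v

theorem christoffel_congr {G G' : Model n → (Model n →L[ℝ] Model n →L[ℝ] ℝ)} {y : Model n}
    (h : G =ᶠ[𝓝 y] G') (u v : Model n) : christoffel G y u v = christoffel G' y u v := by
  rw [christoffel, christoffel, h.fderiv_eq, h.self_of_nhds]

theorem ricciCoord_congr {G G' : Model n → (Model n →L[ℝ] Model n →L[ℝ] ℝ)} {y : Model n}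
    (h : G =ᶠ[𝓝 y] G') (v w : Model n) : ricciCoord G y v w = ricciCoord G' y v w := by
  have hc (u v : Model n) :
      (fun z ↦ christoffel G z u v) =ᶠ[𝓝 y] fun z ↦ christoffel G' z u v :=
    h.eventuallyEq_nhds.mono fun z hz ↦ christoffel_congr hz u v
  simp only [ricciCoord, riemannCoord, (hc _ _).fderiv_eq, christoffel_congr h]

/-- The Ricci tensor is natural under local diffeomorphisms. Only the germ of the coordinate
representation of `f` at `x` matters, so this reduces to `ricciCoord_flatPullback`. -/
theorem ricci_pullback {g : TwoTensor n N} (hg : IsSmoothTensor g)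
    (hs : ∀ x u v, g x u v = g x v u) (hn : ∀ x u, (∀ v, g x u v = 0) → u = 0)
    {f : M → N} (hf : ContMDiff (𝓡 n) (𝓡 n) ∞ f) (x : M)
    (hfi : (mfderiv (𝓡 n) (𝓡 n) f x).IsInvertible) (v w : TangentSpace (𝓡 n) x) :
    ricci (pullback f g) x v w =
      ricci g (f x) (mfderiv (𝓡 n) (𝓡 n) f x v) (mfderiv (𝓡 n) (𝓡 n) f x w) := by
  set F := extChartAt (𝓡 n) (f x) ∘ f ∘ (extChartAt (𝓡 n) x).symm with hFdef
  have hev := coordRep_pullback g hf x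
  have hFx : F (extChartAt (𝓡 n) x x) = extChartAt (𝓡 n) (f x) (f x) := by simp [hFdef]
  have hdF : fderiv ℝ F (extChartAt (𝓡 n) x x) = mfderiv (𝓡 n) (𝓡 n) f x := by
    refine Eq.trans ?_ (hf.mdifferentiableAt (by simp)).mfderiv.symm
    rw [ModelWithCorners.range_eq_univ, fderivWithin_univ]
    rfl
  have hF : ContDiffAt ℝ ∞ F (extChartAt (𝓡 n) x x) := contDiffAt_writtenInCharts hf x
  have hG := isSmoothTensor_iff_coordRep.1 hg (f x)
  refine (ricciCoord_congr hev v w).trans ((ricciCoord_flatPullback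
    (hF.of_le ENat.LEInfty.out) ?_ ?_ ?_ ?_ ?_ v w).trans ?_)
  · rw [hFx]
    exact hG.of_le ENat.LEInfty.out
  · rw [hdF]
    exact hfi
  · rw [hFx]
    exact isInvertible_coordRep (mem_extChartAt_target _) (hn _)
  · rw [← hev.self_of_nhds]
    have hfi' : (mfderiv (𝓡 n) (𝓡 n) f
        ((extChartAt (𝓡 n) x).symm (extChartAt (𝓡 n) x x))).IsInvertible := by
      rwa [extChartAt_to_inv]
    refine isInvertible_coordRep (mem_extChartAt_target _) fun u hu ↦ ?_
    refine hfi'.injective (Eq.trans (hn _ _ fun v ↦ ?_) (map_zero _).symm)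
    obtain ⟨v, rfl⟩ := hfi'.surjective v
    exact hu v
  · exact .of_forall fun z u v ↦ hs _ _ _
  · rw [hFx, hdF]
    rfl

end Charts

/-! ### Diffeomorphisms -/

section Diffeo

variable {M N : Type*} {E H E' H' : Type*} [NormedAddCommGroup E] [NormedSpace ℝ E]
  [TopologicalSpace H] {I : ModelWithCorners ℝ E H} [NormedAddCommGroup E'] [NormedSpace ℝ E']
  [TopologicalSpace H'] {J : ModelWithCorners ℝ E' H'}
  [TopologicalSpace M] [ChartedSpace H M] [TopologicalSpace N] [ChartedSpace H' N]
  [IsManifold J ∞ N]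

theorem isImmersion_diffeomorph_comp {f : M → N} (hf : Manifold.IsImmersion I J ∞ f)
    (d : Diffeomorph J J N N ∞) : Manifold.IsImmersion I J ∞ (d ∘ f) := by
  obtain ⟨F, _, _, h⟩ := hf
  refine ⟨F, inferInstance, inferInstance, fun x ↦ ?_⟩
  have hx := h x
  refine Manifold.IsImmersionAtOfComplement.mk_of_charts hx.equiv hx.domChart
    (d.symm.toHomeomorph.transOpenPartialHomeomorph hx.codChart) hx.mem_domChart_source ?_
    hx.domChart_mem_maximalAtlas ?_ ?_ ?_
  · simpa using hx.mem_codChart_source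
  · rw [IsManifold.mem_maximalAtlas_iff_contMDiffOn]
    constructor
    · exact (contMDiffOn_of_mem_maximalAtlas hx.codChart_mem_maximalAtlas).comp
        d.symm.contMDiff.contMDiffOn fun y hy ↦ hy
    · exact d.contMDiff.comp_contMDiffOn
        (contMDiffOn_symm_of_mem_maximalAtlas hx.codChart_mem_maximalAtlas)
  · intro y hy
    simpa using hx.source_subset_preimage_source hy
  · intro y hy
    simpa using hx.writtenInCharts hy

theorem isSmoothEmbedding_diffeomorph_comp {f : M → N} (hf : Manifold.IsSmoothEmbedding I J ∞ f)
    (d : Diffeomorph J J N N ∞) : Manifold.IsSmoothEmbedding I J ∞ (d ∘ f) :=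
  ⟨isImmersion_diffeomorph_comp hf.isImmersion d,
    d.toHomeomorph.isEmbedding.comp hf.isEmbedding⟩

end Diffeo

section Pullback

variable {n m k : ℕ} {M : Type*} [TopologicalSpace M] [ChartedSpace (Model n) M]
  {N : Type*} [TopologicalSpace N] [ChartedSpace (Model m) N]
  {P : Type*} [TopologicalSpace P] [ChartedSpace (Model k) P]

theorem pullback_apply (f : M → N) (g : TwoTensor m N) (x : M) (u v : TangentSpace (𝓡 n) x) :
    pullback f g x u v = g (f x) (mfderiv (𝓡 n) (𝓡 m) f x u) (mfderiv (𝓡 n) (𝓡 m) f x v) := rfl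

theorem pullback_comp {f : M → N} {f' : N → P} (hf : MDifferentiable (𝓡 n) (𝓡 m) f)
    (hf' : MDifferentiable (𝓡 m) (𝓡 k) f') (g : TwoTensor k P) :
    pullback (n := n) (m := m) f (pullback f' g) = pullback (f' ∘ f) g := by
  ext x u v
  have h (u : TangentSpace (𝓡 n) x) := congr($(mfderiv_comp x (hf' _) (hf x)) u)
  simp only [pullback_apply, h]
  rfl

theorem mfderiv_eq_id_of_eventuallyEq {f : M → M} {x : M} (h : f =ᶠ[𝓝 x] id)
    (u : TangentSpace (𝓡 n) x) : (mfderiv (𝓡 n) (𝓡 n) f x u : Model n) = u := by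
  have h1 := congr($(h.mfderiv_eq (I := 𝓡 n) (I' := 𝓡 n)) u)
  rw [mfderiv_id] at h1
  exact h1

/-- A map that is the identity near a point does not change tensor fields there. -/
theorem pullback_eventuallyEq {f : M → M} {x : M} (h : f =ᶠ[𝓝 x] id) (g : TwoTensor n M) :
    ∀ᶠ y in 𝓝 x, pullback f g y = g y := by
  filter_upwards [h.eventuallyEq_nhds] with y hy
  ext u v
  refine (apply_congr_point g (q := y) hy.self_of_nhds _ _).trans ?_
  exact congrArg₂ (fun a b : Model n ↦ g y a b) (mfderiv_eq_id_of_eventuallyEq hy u)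
    (mfderiv_eq_id_of_eventuallyEq hy v)

theorem coordRep_congr {g g' : TwoTensor n M} {x : M} (h : ∀ᶠ y in 𝓝 x, g y = g' y) :
    coordRep g x =ᶠ[𝓝 (extChartAt (𝓡 n) x x)] coordRep g' x := by
  have hc := (continuousAt_extChartAt_symm (I := 𝓡 n) x)
  rw [ContinuousAt, extChartAt_to_inv] at hc
  filter_upwards [hc.eventually h] with z hz
  rw [coordRep, coordRep, pullback, pullback, hz]

theorem covDerivAlong_congr {g g' : TwoTensor n M} {f : N → M}
    {Z : ∀ q : N, TangentSpace (𝓡 n) (f q)} {p : N} (h : ∀ᶠ y in 𝓝 (f p), g y = g' y)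
    (u : TangentSpace (𝓡 m) p) : covDerivAlong g f Z p u = covDerivAlong g' f Z p u :=
  congrArg (fun a : Model n ↦ (mvfderiv (𝓡 m)
    (fun q ↦ mvfderiv (𝓡 n) (extChartAt (𝓡 n) (f p)) (f q) (Z q)) p u : Model n) + a)
    (christoffel_congr (coordRep_congr h) _ _)

end Pullback

/-! ### Lorentzian metrics -/

section Spacetime

variable {M : Type u} [TopologicalSpace M] [ChartedSpace (Model 4) M] [IsManifold (𝓡 4) ∞ M]
  {g : TwoTensor 4 M} {T : VField 4 M}

/-- The metric in the components with respect to an orthonormal frame. -/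
theorem IsLorentzian.exists_frame (hg : IsLorentzian g) (x : M) :
    ∃ b : Module.Basis (Fin 4) ℝ (TangentSpace (𝓡 4) x), ∀ v w,
      g x v w = -(b.repr v 0 * b.repr w 0) + b.repr v 1 * b.repr w 1
        + b.repr v 2 * b.repr w 2 + b.repr v 3 * b.repr w 3 := by
  obtain ⟨b, hb⟩ := hg.signature x
  refine ⟨b, fun v w ↦ ?_⟩
  conv_lhs => rw [← b.sum_repr v, ← b.sum_repr w]
  rw [Fin.sum_univ_four, Fin.sum_univ_four]
  simp [hb]

theorem IsLorentzian.nondegenerate (hg : IsLorentzian g) (x : M) (u : TangentSpace (𝓡 4) x)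
    (hu : ∀ v, g x u v = 0) : u = 0 := by
  obtain ⟨b, hb⟩ := hg.exists_frame x
  have h (i : Fin 4) : b.repr u i = 0 := by
    have := hu (b i)
    rw [hb] at this
    fin_cases i <;> simpa using this
  exact b.repr.map_eq_zero_iff.1 (Finsupp.ext h)

/-- Two future-directed causal vectors, one of which is timelike, have negative inner product. -/
theorem IsFutureDirected.inner_neg (hg : IsLorentzian g) {x : M} {a c : TangentSpace (𝓡 4) x}
    (hT : g x (T x) (T x) < 0) (ha : IsFutureDirected g T x a) (hc : IsFutureDirected g T x c)
    (hcc : g x c c < 0) : g x a c < 0 := by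
  obtain ⟨b, hb⟩ := hg.exists_frame x
  exact lorentz_inner_neg (fun v w ↦ g x v w) b hb ha.1 hcc hT ha.2 hc.2

variable {ψ : Diffeomorph (𝓡 4) (𝓡 4) M M ∞}

omit [IsManifold (𝓡 4) ∞ M] in
theorem isInvertible_mfderiv_diffeomorph (ψ : Diffeomorph (𝓡 4) (𝓡 4) M M ∞) (x : M) :
    (mfderiv (𝓡 4) (𝓡 4) ψ x).IsInvertible :=
  ⟨ψ.mfderivToContinuousLinearEquiv (by simp) x, rfl⟩

theorem IsLorentzian.pullback (hg : IsLorentzian g) : IsLorentzian (pullback ψ g) where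
  smooth := isSmoothTensor_pullback hg.smooth ψ.contMDiff
  symm x u w := hg.symm _ _ _
  signature x := by
    obtain ⟨b, hb⟩ := hg.signature (ψ x)
    obtain ⟨e, he⟩ := isInvertible_mfderiv_diffeomorph ψ x
    refine ⟨b.map e.symm.toLinearEquiv, fun i j ↦ ?_⟩
    rw [pullback_apply, ← he, ← hb]
    simp

theorem isTimeOrientation_mpullback (hT : IsTimeOrientation g T) :
    IsTimeOrientation (pullback ψ g) (VectorField.mpullback (𝓡 4) (𝓡 4) ψ T) where
  smooth := hT.smooth.mpullback_vectorField ψ.contMDiff (isInvertible_mfderiv_diffeomorph ψ)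
    (by simp)
  timelike x := by
    rw [pullback_apply, VectorField.mpullback_apply,
      (isInvertible_mfderiv_diffeomorph ψ x).self_apply_inverse]
    exact hT.timelike _

omit [IsManifold (𝓡 4) ∞ M] in
theorem preservesTimeOrientation_mpullback :
    PreservesTimeOrientation ψ (pullback ψ g) (VectorField.mpullback (𝓡 4) (𝓡 4) ψ T) g T := by
  intro x w hw
  refine ⟨hw.1, ?_⟩
  have := hw.2
  rwa [pullback_apply, VectorField.mpullback_apply,
      (isInvertible_mfderiv_diffeomorph ψ x).self_apply_inverse] at this

/-- If `ψ` maps future-directed vectors to future-directed vectors, then it also reflects them. -/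
theorem isFutureDirected_of_mfderiv {T' : VField 4 M} (hg : IsLorentzian g)
    (hT : IsTimeOrientation g T) (hT' : IsTimeOrientation (pullback ψ g) T')
    (hp : PreservesTimeOrientation ψ (pullback ψ g) T' g T) {x : M} {w : TangentSpace (𝓡 4) x}
    (hw : IsFutureDirected g T (ψ x) (mfderiv (𝓡 4) (𝓡 4) ψ x w)) :
    IsFutureDirected (pullback ψ g) T' x w := by
  have h := hT'.timelike x
  -- `T'` is itself future-directed, so `dψ T'` is future-directed for `T`
  exact ⟨hw.1, IsFutureDirected.inner_neg hg (hT.timelike _) hw (hp x (T' x) ⟨h.le, h⟩) h⟩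

omit [IsManifold (𝓡 4) ∞ M] in
theorem IsInextendibleTimelikeCurve.diffeomorph_comp {γ : ℝ → M}
    (hγ : IsInextendibleTimelikeCurve (pullback ψ g) γ) :
    IsInextendibleTimelikeCurve g (ψ ∘ γ) where
  smooth := ψ.contMDiff.comp hγ.smooth
  timelike t := by
    have h := congr($(mfderiv_comp t (ψ.contMDiff.mdifferentiableAt (by simp))
      (hγ.smooth.mdifferentiableAt (by simp) (x := t))) (1 : ℝ))
    have h2 := hγ.timelike t
    rw [pullback_apply] at h2
    rw [h]
    exact h2
  no_future_endpoint p hp := hγ.no_future_endpoint (ψ.symm p) (by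
    simpa [Function.comp_def] using (ψ.symm.continuous.tendsto p).comp hp)
  no_past_endpoint p hp := hγ.no_past_endpoint (ψ.symm p) (by
    simpa [Function.comp_def] using (ψ.symm.continuous.tendsto p).comp hp)

end Spacetime

/-! ### Developments -/

section Developments

variable {S : Type v} [TopologicalSpace S] [ChartedSpace (Model 3) S] [IsManifold (𝓡 3) ∞ S]
  {D : InitialData S}
  {M : Type u} [TopologicalSpace M] [ChartedSpace (Model 4) M] [IsManifold (𝓡 4) ∞ M]
  {g : TwoTensor 4 M} {T T' : VField 4 M} {ι : S → M} {ψ : Diffeomorph (𝓡 4) (𝓡 4) M M ∞}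

omit [IsManifold (𝓡 3) ∞ S] [IsManifold (𝓡 4) ∞ M] in
theorem pullback_pullback_of_eventuallyEq_id (hψ : ∀ p, ψ =ᶠ[𝓝 (ι p)] id) :
    pullback (n := 3) (m := 4) ι (pullback ψ g) = pullback ι g := by
  funext p
  exact congrArg (fun B : TangentSpace (𝓡 4) (ι p) →L[ℝ] TangentSpace (𝓡 4) (ι p) →L[ℝ] ℝ ↦
    (mfderiv (𝓡 3) (𝓡 4) ι p).precomp ℝ ∘L B ∘L mfderiv (𝓡 3) (𝓡 4) ι p)
    (pullback_eventuallyEq (hψ p) g).self_of_nhds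

omit [IsManifold (𝓡 3) ∞ S] in
/-- The second fundamental form depends only on the germ of the metric along `ι`, and the unit
normal `N` stays the future-directed one: `dψ` fixes `N`, and `ψ` reflects future-directedness. -/
theorem IsExtrinsicCurvature.pullback {k : TwoTensor 3 S} (h : IsExtrinsicCurvature g T ι k)
    (hgl : IsLorentzian g) (hT : IsTimeOrientation g T) (hψ : ∀ p, ψ =ᶠ[𝓝 (ι p)] id)
    (hT' : IsTimeOrientation (pullback ψ g) T')
    (hp : PreservesTimeOrientation ψ (pullback ψ g) T' g T) :
    IsExtrinsicCurvature (pullback ψ g) T' ι k := by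
  obtain ⟨N, hN, hk⟩ := h
  have hg (p : S) := pullback_eventuallyEq (hψ p) g
  have hgp (p : S) : GR.pullback ψ g (ι p) = g (ι p) := (hg p).self_of_nhds
  refine ⟨N, fun p ↦ ⟨?_, ?_, ?_⟩, fun p u w ↦ ?_⟩
  · refine isFutureDirected_of_mfderiv hgl hT hT' hp ?_
    have key (q : M) (e : q = ι p) (a : Model 4) (ha : a = N p) : IsFutureDirected g T q a := by
      subst e ha
      exact (hN p).1
    exact key _ (hψ p).self_of_nhds _ (mfderiv_eq_id_of_eventuallyEq (hψ p) _)
  · exact congr($(hgp p) (N p) (N p)).trans (hN p).2.1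
  · exact fun u ↦ congr($(hgp p) (N p) _).trans ((hN p).2.2 u)
  · rw [hk, hgp, covDerivAlong_congr (hg p)]

/-- A development of the data pulls back to a development of the same data under a diffeomorphism
that is the identity near the Cauchy surface. -/
theorem IsDevelopment.pullback (h : IsDevelopment D g T ι)
    (hψ : ∀ p, ψ =ᶠ[𝓝 (ι p)] id)
    (hT' : IsTimeOrientation (pullback ψ g) T')
    (hp : PreservesTimeOrientation ψ (pullback ψ g) T' g T) :
    IsDevelopment D (pullback ψ g) T' ι where
  lorentzian := h.lorentzian.pullback
  timeOrientation := hT'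
  ricci_eq_zero x v w := by
    rw [ricci_pullback h.lorentzian.smooth h.lorentzian.symm h.lorentzian.nondegenerate
      ψ.contMDiff x (isInvertible_mfderiv_diffeomorph ψ x)]
    exact h.ricci_eq_zero _ _ _
  embedding := h.embedding
  cauchy γ hγ := by
    have hmem (t : ℝ) : γ t ∈ range ι ↔ (ψ ∘ γ) t ∈ range ι := by
      constructor
      · rintro ⟨p, hp⟩
        exact ⟨p, by rw [Function.comp_apply, ← hp, (hψ p).self_of_nhds, id]⟩
      · rintro ⟨p, hp⟩
        refine ⟨p, ψ.injective (?_ : ψ (ι p) = ψ (γ t))⟩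
        rw [(hψ p).self_of_nhds, id, hp, Function.comp_apply]
    simpa only [hmem] using h.cauchy _ hγ.diffeomorph_comp
  induced_metric := (pullback_pullback_of_eventuallyEq_id hψ).trans h.induced_metric
  extrinsic_curvature := h.extrinsic_curvature.pullback h.lorentzian h.timeOrientation hψ hT' hp

/-- Maximality survives because the embedding `θ` of a development into `(M, g)` becomes the
embedding `ψ⁻¹ ∘ θ` into `(M, ψ^* g)`. -/
theorem IsMGHD.pullback (h : IsMGHD D g T ι) (hψ : ∀ p, ψ =ᶠ[𝓝 (ι p)] id)
    (hT' : IsTimeOrientation (pullback ψ g) T')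
    (hp : PreservesTimeOrientation ψ (pullback ψ g) T' g T) :
    IsMGHD D (pullback ψ g) T' ι := by
  refine ⟨h.1.pullback hψ hT' hp, ?_⟩
  intro M' _ _ _ _ _ _ g₁ T₁ ι₁ h₁
  obtain ⟨θ, hθ, rfl, hι, hθT⟩ := h.2 M' g₁ T₁ ι₁ h₁
  have hψd : MDifferentiable (𝓡 4) (𝓡 4) ψ := ψ.contMDiff.mdifferentiable (by simp)
  have hψd' : MDifferentiable (𝓡 4) (𝓡 4) ψ.symm := ψ.symm.contMDiff.mdifferentiable (by simp)
  have hθd : MDifferentiable (𝓡 4) (𝓡 4) θ := hθ.contMDiff.mdifferentiable (by simp)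
  have hcomp : ψ ∘ (ψ.symm ∘ θ) = θ := by ext x; simp
  refine ⟨ψ.symm ∘ θ, isSmoothEmbedding_diffeomorph_comp hθ _, ?_, ?_, ?_⟩
  · rw [pullback_comp (hψd'.comp hθd) hψd, hcomp]
  · ext p
    refine ψ.injective (?_ : ψ _ = ψ _)
    rw [(hψ p).self_of_nhds]
    simpa using congrFun hι p
  · intro x w hw
    refine isFutureDirected_of_mfderiv h.1.lorentzian h.1.timeOrientation hT' hp ?_
    have key (f : M' → M) (e : f = θ) : IsFutureDirected g T (f x) (mfderiv (𝓡 4) (𝓡 4) f x w) := by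
      subst e
      exact hθT x w hw
    have h2 := congr($(mfderiv_comp x (hψd _) ((hψd'.comp hθd) x)) w)
    have h3 := key _ hcomp
    rw [h2] at h3
    exact h3

end Developments

end GR

end

theorem proposition1
    {S : Type*} [TopologicalSpace S] [ChartedSpace (GR.Model 3) S] [IsManifold (𝓡 3) ∞ S]
    [T2Space S] [SecondCountableTopology S] (D : GR.InitialData S)
    {M : Type*} [TopologicalSpace M] [ChartedSpace (GR.Model 4) M] [IsManifold (𝓡 4) ∞ M]
    [T2Space M] [SecondCountableTopology M] [ConnectedSpace M]
    (g : GR.TwoTensor 4 M) (T : GR.VField 4 M) (ι : S → M) (h : GR.IsMGHD D g T ι)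
    (U : Set M) (hU : U ∈ 𝓝ˢ (range ι))
    (ψ : Diffeomorph (𝓡 4) (𝓡 4) M M ∞) (hψ : ∀ x ∈ U, ψ x = x) :
    GR.IsMGHD D (GR.pullback ψ g) (VectorField.mpullback (𝓡 4) (𝓡 4) ψ T) ι ∧
    ∀ T' : GR.VField 4 M, GR.IsTimeOrientation (GR.pullback ψ g) T' →
      GR.PreservesTimeOrientation ψ (GR.pullback ψ g) T' g T →
      GR.IsMGHD D (GR.pullback ψ g) T' ι := by
  have hid (p : S) : ψ =ᶠ[𝓝 (ι p)] id :=
    Filter.mem_of_superset (mem_nhdsSet_iff_forall.1 hU _ (mem_range_self p)) hψ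
  exact ⟨h.pullback hid (GR.isTimeOrientation_mpullback h.1.timeOrientation)
    GR.preservesTimeOrientation_mpullback, fun T' hT' hp ↦ h.pullback hid hT' hp⟩
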